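/- Consider the (sum) network creation game on a finite set $V$ of $n$ players with link price $\alpha>0$: every player $u$ chooses a set $s_u\subseteq V\setminus\{u\}$, the choices $s=(s_u)_{u\in V}$ form the undirected graph $G_s$ on $V$ in which $u,v$ are adjacent if and only if $v\in s_u$ or $u\in s_v$, and the cost of player $u$ is $c_u(s)=\alpha|s_u|+\sum_{v\ne u}d_{G_s}(u,v)$, where $d_{G_s}(u,v)=\infty$ if $u$ and $v$ lie in different components. The strategy vector $s$ is a Nash equilibrium if $c_u(s)\le c_u(s')$ for every player $u$ and every strategy vector $s'$ that differs from $s$ only in the strategy of $u$. Let $\alpha>4n$, let $s$ be a Nash equilibrium and let $G=G_s$. Let $H\subseteq G$ be a $2$-edge-connected component of $G$, that is, a maximal connected subgraph of $G$ that has no bridges. If the girth of $G$ satisfies $g(G)\ge 20$ (with $g(G)=\infty$ if $G$ has no cycle) and $\operatorname{diam}(H)\ge 126$, then the average degree of $H$ satisfies $$\deg(H)=\frac{1}{|V(H)|}\sum_{v\in V(H)}\deg_H(v)\ \ge\ 2+\frac12 .$$ -/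

import Mathlib

open scoped ENNReal

/-- A strategy vector of the network creation game on the set of players `V`: each player `u`
chooses a set `links u` of other players, to each of which `u` buys a link. -/
structure StrategyVector (V : Type*) where
  links : V → Finset V
  notMem_links : ∀ u, u ∉ links u

namespace StrategyVector

variable {V : Type*}

/-- The (undirected) communication network of a strategy vector. -/
def network (s : StrategyVector V) : SimpleGraph V where
  Adj u v := v ∈ s.links u ∨ u ∈ s.links v
  symm := ⟨fun _ _ h => h.symm⟩
  loopless := ⟨fun u h => h.elim (s.notMem_links u) (s.notMem_links u)⟩

/-- The cost of player `u` for the link price `α ≥ 0`: `α` for each link that `u` buys, plus the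
sum of the distances from `u` to all players, the distance to a player in another connected
component being `∞`.  (The summand for `v = u` is `0`.) -/
noncomputable def cost [Fintype V] (s : StrategyVector V) (α : ℝ) (u : V) : ℝ≥0∞ :=
  ENNReal.ofReal α * ((s.links u).card : ℝ≥0∞) + ∑ v : V, ((s.network.edist u v : ℕ∞) : ℝ≥0∞)

/-- `s` is a Nash equilibrium for the link price `α`: no player `u` has a smaller cost in a
strategy vector `s'` that differs from `s` only in the strategy of `u`. -/
def IsNashEquilibrium [Fintype V] (s : StrategyVector V) (α : ℝ) : Prop :=
  ∀ (u : V) (s' : StrategyVector V), (∀ v, v ≠ u → s'.links v = s.links v) →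
    s.cost α u ≤ s'.cost α u

end StrategyVector

namespace SimpleGraph

/-- A graph is 2-edge-connected if it is connected and none of its edges is a bridge. -/
def IsTwoEdgeConnected {W : Type*} (G : SimpleGraph W) : Prop :=
  G.Connected ∧ ∀ e ∈ G.edgeSet, ¬ G.IsBridge e

namespace Subgraph

variable {V : Type*} {G : SimpleGraph V}

/-- `H` is a 2-edge-connected component of `G`: a maximal 2-edge-connected subgraph of `G`. -/
def IsTwoEdgeConnectedComponent (H : G.Subgraph) : Prop :=
  Maximal (fun K : G.Subgraph => K.coe.IsTwoEdgeConnected) H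

open Classical in
/-- The average over the vertices of `H` of the degree in `H`. -/
noncomputable def averageDegree [Fintype V] (H : G.Subgraph) : ℝ :=
  (∑ v ∈ H.verts.toFinset, (H.degree v : ℝ)) / (H.verts.toFinset.card : ℝ)

end Subgraph

end SimpleGraph

/-!
Let `n` be the number of players, so that `4n < α`. The bound on the average degree follows once at
most half of the vertices of `H` have degree 2 in `H`, since `H` is connected, bridgeless and not a
single vertex, so that all other vertices have degree at least 3 in `H`.

The branch at a vertex `v` of `H` is the component of `v` after deletion of the edges of `H`. By
maximality of `H`, distinct vertices have disjoint branches
(`IsTwoEdgeConnectedComponent.disjoint_branch`).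

Let `v` have degree 2 in `H`.

* `v` does not buy both of its links in `H` (`exists_mem_links`). Otherwise take the edge opposite to
  `v` on a shortest cycle through `v` and a player `u` buying it. If `u` moves this link to `v`, each
  of its distances becomes at most one more than the distance from `v`; if `v` replaces its two links
  by one to `u`, each of its distances becomes at most one more than the distance from `u`. Adding
  the two equilibrium inequalities gives `α ≤ 2n`.
* Hence some neighbour `u` buys the link to `v`. Let `A` be the set of vertices that `u` reaches only
  through this link. Moving the link to the other neighbour of `v` brings the part of `A` outside the
  branch at `v` closer by one and only the branch further away by one, so at least half of `A` lies
  in the branch. Dropping the link lengthens the distances to `A` by at most `|V(H)| - 2`, since the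
  link lies on a cycle in `H`. So `α ≤ 2 (|V(H)| - 2) |branch v|` (`le_mul_card_branch`).

Summing over the vertices of degree 2, whose branches have at most `n < α / 4` vertices in total,
shows that there are at most `(|V(H)| - 2) / 2` of them (`two_mul_card_le`).
-/

/-! ### Distances after the deletion of edges, and 2-edge-connected subgraphs -/

namespace SimpleGraph

variable {V : Type*} {G K : SimpleGraph V}

theorem edist_le_add_one {x y z : V} (h : G.Adj y z) : G.edist x z ≤ G.edist x y + 1 :=
  G.edist_triangle.trans (add_le_add_right (edist_eq_one_iff_adj.2 h).le _)

/-- A function that vanishes at `x` and grows by at most one along every edge is bounded by the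
distance from `x`. The effects of deviations on distances are bounded through such functions. -/
theorem le_edist_of_le_add_one {x : V} (f : V → ℕ∞) (hx : f x = 0)
    (hf : ∀ y z, G.Adj y z → f z ≤ f y + 1) (z : V) : f z ≤ G.edist x z := by
  have key : ∀ (y z : V) (p : G.Walk y z), f z ≤ f y + p.length := by
    intro y z p
    induction p with
    | nil => simp
    | @cons a b c h p ih =>
      refine ih.trans ?_
      rw [Walk.length_cons, Nat.cast_add, Nat.cast_one, add_comm (p.length : ℕ∞), ← add_assoc]
      exact add_le_add_left (hf _ _ h) _
  refine le_iInf fun p => ?_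
  simpa [hx] using key x z p

/-- A shortest walk from `x` to the nearer end `b` of an edge `ab` does not use that edge. -/
theorem edist_deleteEdges_le_of_lt {x a b : V} (h : K.edist x b < K.edist x a) :
    (K.deleteEdges {s(a, b)}).edist x b ≤ K.edist x b := by
  set K' := K.deleteEdges {s(a, b)} with hK'
  have hle : K' ≤ K := deleteEdges_le _
  have hM : K.edist x b + 1 ≤ K'.edist x a :=
    (Order.add_one_le_of_lt h).trans (edist_anti hle)
  have hb : K.edist x b ≤ K'.edist x b := edist_anti hle
  have hfin : K.edist x b < K.edist x b + 1 := by
    rw [ENat.lt_add_one_iff (ne_top_of_lt h)]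
  have := le_edist_of_le_add_one (G := K) (x := x)
    (fun z => min (K'.edist x z) (K.edist x b + 1)) (by simp) (fun y z hyz => ?_) b
  · rcases min_le_iff.1 this with h1 | h1
    · exact h1
    · exact absurd h1 (not_le.2 hfin)
  · by_cases he : s(y, z) = s(a, b)
    · rcases Sym2.eq_iff.1 he with ⟨rfl, rfl⟩ | ⟨rfl, rfl⟩
      · simp only [min_eq_right hM]
        exact (min_le_right _ _).trans le_self_add
      · refine (min_le_right _ _).trans ?_
        gcongr
        exact le_min hb le_self_add
    · have : K'.Adj y z := by simp [hK', hyz, he]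
      rw [min_add]
      exact min_le_min (edist_le_add_one this) le_self_add

/-- If both ends of an edge can be reached from `x` without it, and no later than through it, then
deleting the edge changes no distance from `x`. -/
theorem edist_deleteEdges_le {x a b : V}
    (hab : (G.deleteEdges {s(a, b)}).edist x b ≤ G.edist x a + 1)
    (hba : (G.deleteEdges {s(a, b)}).edist x a ≤ G.edist x b + 1) (z : V) :
    (G.deleteEdges {s(a, b)}).edist x z ≤ G.edist x z := by
  have hle : G.deleteEdges {s(a, b)} ≤ G := deleteEdges_le _
  refine le_edist_of_le_add_one _ (by simp) (fun y z hyz => ?_) z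
  by_cases he : s(y, z) = s(a, b)
  · rcases Sym2.eq_iff.1 he with ⟨rfl, rfl⟩ | ⟨rfl, rfl⟩
    · exact hab.trans (add_le_add_left (edist_anti hle) _)
    · exact hba.trans (add_le_add_left (edist_anti hle) _)
  · exact edist_le_add_one (by simp [hyz, he])

/-- Deleting an edge `uv` that lies on a cycle of length at most `k + 2` lengthens the distances
from `u` by at most `k`. -/
theorem edist_deleteEdges_le_add (u v : V) {k : ℕ}
    (h : (G.deleteEdges {s(u, v)}).edist u v ≤ k + 1) (z : V) :
    (G.deleteEdges {s(u, v)}).edist u z ≤ G.edist u z + k := by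
  set G₁ := G.deleteEdges {s(u, v)} with hG₁
  have hf := le_edist_of_le_add_one (G := G) (x := u)
    (fun z => min (G₁.edist u z) (1 + G₁.edist v z)) (by simp) (fun y z hyz => ?_) z
  · rcases min_le_iff.1 hf with hf | hf
    · exact hf.trans le_self_add
    · calc G₁.edist u z ≤ G₁.edist u v + G₁.edist v z := G₁.edist_triangle
        _ ≤ (k + 1) + G₁.edist v z := by gcongr
        _ = (1 + G₁.edist v z) + k := by ring
        _ ≤ _ := by gcongr
  · by_cases he : s(y, z) = s(u, v)
    · rcases Sym2.eq_iff.1 he with ⟨rfl, rfl⟩ | ⟨rfl, rfl⟩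
      · simp
      · simp
    · have : G₁.Adj y z := by simp [hG₁, hyz, he]
      rw [min_add, add_assoc]
      exact min_le_min (edist_le_add_one this) (add_le_add_right (edist_le_add_one this) _)

/-- A trail through the edge `ab` splits, once that edge is dropped, into a part joining its start
to one of `a`, `b` and a part joining the other one to its end. Here `P` is any graph that contains
the remaining edges of the trail. -/
theorem Walk.IsTrail.reachable_deleteEdges {P : SimpleGraph V} {a b x y : V} {p : G.Walk x y}
    (hp : p.IsTrail)
    (hP : ∀ e ∈ p.edges, e ≠ s(a, b) → e ∈ P.edgeSet) (he : s(a, b) ∈ p.edges) :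
    P.Reachable x a ∧ P.Reachable b y ∨ P.Reachable x b ∧ P.Reachable a y := by
  induction p with
  | nil => simp at he
  | @cons x z y h p ih =>
    rw [Walk.isTrail_cons] at hp
    by_cases hxz : s(x, z) = s(a, b)
    · have hr : P.Reachable z y :=
        ⟨p.transfer P fun e hep => hP e (by simp [hep]) fun h' => hp.2 (hxz ▸ h' ▸ hep)⟩
      rcases Sym2.eq_iff.1 hxz with ⟨rfl, rfl⟩ | ⟨rfl, rfl⟩
      · exact .inl ⟨.rfl, hr⟩
      · exact .inr ⟨.rfl, hr⟩
    · have hx : P.Reachable x z := Adj.reachable (hP s(x, z) (by simp) hxz)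
      have he' : s(a, b) ∈ p.edges := by
        rw [Walk.edges_cons, List.mem_cons] at he
        exact he.resolve_left fun h => hxz h.symm
      rcases ih hp.1 (fun e h1 h2 => hP e (by simp [h1]) h2) he' with ⟨h1, h2⟩ | ⟨h1, h2⟩
      · exact .inl ⟨hx.trans h1, h2⟩
      · exact .inr ⟨hx.trans h1, h2⟩

namespace Subgraph

theorem reachable_coe_deleteEdges {H : G.Subgraph} {a b : H.verts} {x y : V}
    (hx : x ∈ H.verts) (hy : y ∈ H.verts)
    (h : (H.spanningCoe.deleteEdges {s((a : V), (b : V))}).Reachable x y) :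
    (H.coe.deleteEdges {s(a, b)}).Reachable ⟨x, hx⟩ ⟨y, hy⟩ := by
  obtain ⟨p⟩ := h
  induction p with
  | nil => exact .rfl
  | @cons x z y h p ih =>
    rw [SimpleGraph.deleteEdges_adj] at h
    have hz : z ∈ H.verts := H.edge_vert (Subgraph.Adj.symm h.1)
    refine .trans (Adj.reachable ?_) (ih hz hy)
    rw [SimpleGraph.deleteEdges_adj]
    refine ⟨h.1, fun h' => h.2 ?_⟩
    have := congrArg (Sym2.map Subtype.val) (Set.mem_singleton_iff.1 h')
    simpa using this

/-- Distinct vertices of a 2-edge-connected component `H` are not joined outside `H`: a path joining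
them by edges not in `H` would, added to `H`, give a larger 2-edge-connected subgraph. -/
theorem IsTwoEdgeConnectedComponent.eq_of_reachable {H : G.Subgraph}
    (hH : H.IsTwoEdgeConnectedComponent) {x y : V} (hx : x ∈ H.verts) (hy : y ∈ H.verts)
    (h : (G.deleteEdges H.edgeSet).Reachable x y) : x = y := by
  obtain ⟨q, hq⟩ := h.exists_isPath
  have hle : G.deleteEdges H.edgeSet ≤ G := SimpleGraph.deleteEdges_le _
  have hnot : ∀ e ∈ q.edges, e ∉ H.edgeSet := fun e he => by
    have := q.edges_subset_edgeSet he
    rw [edgeSet_deleteEdges] at this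
    exact this.2
  set p := q.mapLe hle with hp
  have hpt : p.IsTrail := (hq.mapLe hle).isTrail
  have hpe : p.edges = q.edges := by simp [hp]
  have hconn : H.Connected := ⟨hH.prop.1⟩
  have hK : (H ⊔ p.toSubgraph).coe.IsTwoEdgeConnected := by
    have hs : (H ⊔ p.toSubgraph).Connected :=
      connected_sup hconn.preconnected p.toSubgraph_connected.preconnected ⟨x, hx, by simp⟩
    refine ⟨hs.coe, fun e => ?_⟩
    induction e with | _ a b =>
    intro hab
    rw [isBridge_iff, not_not]
    have hab' : (H ⊔ p.toSubgraph).Adj a b := hab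
    rw [Subgraph.sup_adj] at hab'
    by_cases hHab : H.Adj a b
    · have ha := H.edge_vert hHab
      have hb := H.edge_vert hHab.symm
      have := hH.prop.2 s(⟨a, ha⟩, ⟨b, hb⟩) hHab
      rw [isBridge_iff, not_not] at this
      refine this.map (G' := (H ⊔ p.toSubgraph).coe.deleteEdges {s(a, b)})
        ⟨Subgraph.inclusion le_sup_left, fun {c d} hcd => ?_⟩
      rw [SimpleGraph.deleteEdges_adj] at hcd ⊢
      refine ⟨(Subgraph.inclusion (le_sup_left : H ≤ H ⊔ p.toSubgraph)).map_adj hcd.1, ?_⟩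
      intro h'
      apply hcd.2
      have := congrArg (Sym2.map Subtype.val) (Set.mem_singleton_iff.1 h')
      apply Sym2.map.injective Subtype.val_injective
      exact this
    · have hpab : s((a : V), (b : V)) ∈ p.edges := by
        rw [← Walk.mem_edges_toSubgraph]
        exact hab'.resolve_left hHab
      refine reachable_coe_deleteEdges a.2 b.2 ?_
      have hyx :
          ((H ⊔ p.toSubgraph).spanningCoe.deleteEdges {s((a : V), (b : V))}).Reachable x y := by
        have := (hconn.coe.preconnected ⟨x, hx⟩ ⟨y, hy⟩)
        refine this.map (G' := (H ⊔ p.toSubgraph).spanningCoe.deleteEdges {s((a : V), (b : V))})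
          ⟨Subtype.val, fun {c d} hcd => ?_⟩
        rw [SimpleGraph.deleteEdges_adj]
        refine ⟨Or.inl hcd, fun h' => hHab ?_⟩
        have h1 : s((c : V), (d : V)) ∈ H.edgeSet := hcd
        rw [Set.mem_singleton_iff.1 h'] at h1
        exact h1
      have hpK : ∀ e ∈ p.edges, e ≠ s((a : V), (b : V)) →
          e ∈ ((H ⊔ p.toSubgraph).spanningCoe.deleteEdges {s((a : V), (b : V))}).edgeSet := by
        intro e he hne
        rw [edgeSet_deleteEdges]
        refine ⟨?_, hne⟩
        induction e with | _ c d =>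
        exact Or.inr (p.mem_edges_toSubgraph.2 he)
      rcases hpt.reachable_deleteEdges hpK hpab with ⟨h1, h2⟩ | ⟨h1, h2⟩
      · exact h1.symm.trans (hyx.trans h2.symm)
      · exact h2.trans (hyx.symm.trans h1)
  have hmax : p.toSubgraph ≤ H := le_sup_right.trans (hH.le_of_ge hK le_sup_left)
  have hnil : q.edges = [] := by
    rw [List.eq_nil_iff_forall_not_mem]
    exact fun e he => hnot e he (Subgraph.edgeSet_mono hmax (p.mem_edges_toSubgraph.2 (hpe ▸ he)))
  cases q with
  | nil => rfl
  | cons h q => simp at hnil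

/-- The ends of an edge of a bridgeless subgraph `H` are joined in `H` by a path that avoids the
edge, and this path has fewer edges than `H` has vertices. -/
theorem exists_walk_length_lt_of_adj [Fintype V] {H : G.Subgraph}
    (hH : H.coe.IsTwoEdgeConnected) {a b : V} (hab : H.Adj a b) :
    ∃ p : (H.spanningCoe.deleteEdges {s(a, b)}).Walk a b, p.length < H.verts.ncard := by
  classical
  have ha := H.edge_vert hab
  have hb := H.edge_vert hab.symm
  have := hH.2 s(⟨a, ha⟩, ⟨b, hb⟩) hab
  rw [isBridge_iff, not_not] at this
  obtain ⟨q, hq⟩ := this.exists_isPath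
  let φ : H.coe.deleteEdges {s(⟨a, ha⟩, ⟨b, hb⟩)} →g H.spanningCoe.deleteEdges {s(a, b)} :=
    ⟨Subtype.val, fun {c d} hcd => by
      rw [SimpleGraph.deleteEdges_adj] at hcd ⊢
      refine ⟨hcd.1, fun h' => hcd.2 (Sym2.map.injective Subtype.val_injective ?_)⟩
      simpa using Set.mem_singleton_iff.1 h'⟩
  refine ⟨q.map φ, ?_⟩
  rw [Walk.length_map, Set.ncard_eq_toFinset_card', Set.toFinset_card]
  exact hq.length_lt

theorem exists_adj_ne [Fintype V] {H : G.Subgraph}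
    (hH : H.coe.IsTwoEdgeConnected) {a b : V} (hab : H.Adj a b) :
    ∃ c, c ≠ b ∧ H.Adj a c := by
  obtain ⟨p, -⟩ := exists_walk_length_lt_of_adj hH hab
  cases p with
  | nil => exact absurd rfl hab.ne
  | @cons _ c _ h p =>
    rw [SimpleGraph.deleteEdges_adj] at h
    exact ⟨c, fun hc => h.2 (by simp [hc]), h.1⟩

end Subgraph
end SimpleGraph

/-! ### Deviations of a single player -/

namespace StrategyVector

variable {V : Type*}

open Classical in
/-- The strategy vector in which player `u` switches to the strategy `S` and all other players
keep their strategies. -/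
noncomputable def deviate (s : StrategyVector V) (u : V) (S : Finset V) (hS : u ∉ S) :
    StrategyVector V where
  links v := if v = u then S else s.links v
  notMem_links v := by
    split_ifs with h
    · exact h ▸ hS
    · exact s.notMem_links v

theorem adj_deviate {s : StrategyVector V} {u v : V} {S : Finset V} (hS : u ∉ S) (hv : v ∈ S) :
    (s.deviate u S hS).network.Adj u v := by
  left
  simpa [deviate] using hv

/-- After a deviation of `u` only edges from `u` to links it has dropped may be missing. -/
theorem deleteEdges_le_deviate {s : StrategyVector V} {u : V} {S : Finset V} (hS : u ∉ S)
    {R : Set (Sym2 V)} (hR : ∀ x ∈ s.links u, x ∉ S → s(u, x) ∈ R) :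
    s.network.deleteEdges R ≤ (s.deviate u S hS).network := by
  have key : ∀ x y, y ∈ s.links x → s(x, y) ∉ R → (s.deviate u S hS).network.Adj x y := by
    intro x y hxy hr
    left
    by_cases hx : x = u
    · subst hx
      simpa [deviate] using by_contra fun h => hr (hR y hxy h)
    · simpa [deviate, hx] using hxy
  intro x y hxy
  rw [SimpleGraph.deleteEdges_adj] at hxy
  rcases hxy.1 with h | h
  · exact key x y h hxy.2
  · exact (key y x h (by rw [Sym2.eq_swap]; exact hxy.2)).symm

variable [Fintype V] {s : StrategyVector V} {α : ℝ}

/-- In a Nash equilibrium the network is connected, since a player who buys links to everybody has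
finite cost. -/
theorem IsNashEquilibrium.connected (hs : s.IsNashEquilibrium α) (u v : V) :
    s.network.Reachable u v := by
  classical
  have hS : u ∉ Finset.univ.erase u := by simp
  have h := hs u (s.deviate u (Finset.univ.erase u) hS) (fun v hv => by simp [deviate, hv])
  rw [← SimpleGraph.edist_ne_top_iff_reachable]
  intro htop
  have h1 : s.cost α u = ⊤ := by
    rw [cost, ENNReal.add_eq_top]
    refine .inr (ENNReal.sum_eq_top.2 ⟨v, Finset.mem_univ _, ?_⟩)
    rw [htop]
    rfl
  rw [h1, top_le_iff, cost, ENNReal.add_eq_top] at h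
  rcases h with h | h
  · exact ENNReal.mul_ne_top ENNReal.ofReal_ne_top (ENNReal.natCast_ne_top _) h
  · obtain ⟨z, -, hz⟩ := ENNReal.sum_eq_top.1 h
    have hz' : (s.deviate u (Finset.univ.erase u) hS).network.edist u z ≤ 1 := by
      rw [SimpleGraph.edist_le_one_iff_adj_or_eq]
      by_cases huz : u = z
      · exact .inr huz
      · exact .inl (adj_deviate hS (by simp [Ne.symm huz]))
    have : (((s.deviate u (Finset.univ.erase u) hS).network.edist u z : ℕ∞) : ℝ≥0∞) ≤ 1 := by
      exact_mod_cast hz'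
    rw [hz] at this
    simp at this

/-- The equilibrium inequality for a deviation of `u` to `S`, in real numbers, where the distances
after the deviation are replaced by upper bounds `g`. -/
theorem IsNashEquilibrium.le_of_edist_le (hs : s.IsNashEquilibrium α) (hα : 0 ≤ α) {u : V}
    {S : Finset V} (hS : u ∉ S) (g : V → ℕ)
    (hg : ∀ z, (s.deviate u S hS).network.edist u z ≤ g z) :
    α * (s.links u).card + ∑ z, (s.network.dist u z : ℝ) ≤ α * S.card + ∑ z, (g z : ℝ) := by
  have h := hs u (s.deviate u S hS) (fun v hv => by simp [deviate, hv])
  have hl : (s.deviate u S hS).links u = S := by simp [deviate]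
  have conv : ∀ (k : ℕ) (f : V → ℕ), ENNReal.ofReal (α * k + ∑ z, (f z : ℝ)) =
      ENNReal.ofReal α * (k : ℝ≥0∞) + ∑ z, ((f z : ℕ∞) : ℝ≥0∞) := by
    intro k f
    rw [ENNReal.ofReal_add (by positivity) (by positivity), ENNReal.ofReal_mul hα,
      ENNReal.ofReal_natCast, ENNReal.ofReal_sum_of_nonneg (by intros; positivity)]
    simp
  rw [← ENNReal.ofReal_le_ofReal_iff (by positivity), conv, conv]
  calc _ = s.cost α u := by
        rw [cost]
        simp only [(hs.connected u _).coe_dist_eq_edist]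
    _ ≤ _ := h
    _ ≤ _ := by
        rw [cost, hl]
        gcongr with z
        exact_mod_cast hg z

end StrategyVector

/-! ### Branches, and vertices of degree 2 to which a link is bought -/

namespace SimpleGraph.Subgraph

variable {V : Type*} [Fintype V] {G : SimpleGraph V}

open Classical in
/-- The branch of `G` hanging off `H` at `v`: the vertices joined to `v` by a walk that uses no
edge of `H`. -/
noncomputable def branch (H : G.Subgraph) (v : V) : Finset V :=
  {z | (G.deleteEdges H.edgeSet).Reachable v z}

theorem mem_branch {H : G.Subgraph} {v z : V} :
    z ∈ H.branch v ↔ (G.deleteEdges H.edgeSet).Reachable v z := by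
  simp [branch]

theorem self_mem_branch (H : G.Subgraph) (v : V) : v ∈ H.branch v := mem_branch.2 .rfl

namespace IsTwoEdgeConnectedComponent

variable {H : G.Subgraph} {v x y z : V}

theorem eq_of_mem_branch (hH : H.IsTwoEdgeConnectedComponent) (hv : v ∈ H.verts)
    (hx : x ∈ H.verts) (h : x ∈ H.branch v) : x = v :=
  (hH.eq_of_reachable hv hx (mem_branch.1 h)).symm

theorem notMem_branch_of_adj (hH : H.IsTwoEdgeConnectedComponent) (h : H.Adj v x) :
    x ∉ H.branch v := fun hx =>
  h.ne (hH.eq_of_mem_branch (H.edge_vert h) (H.edge_vert h.symm) hx).symm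

theorem disjoint_branch (hH : H.IsTwoEdgeConnectedComponent) (hx : x ∈ H.verts)
    (hy : y ∈ H.verts) (hxy : x ≠ y) : Disjoint (H.branch x) (H.branch y) :=
  Finset.disjoint_left.2 fun _ h1 h2 => hxy <|
    hH.eq_of_reachable hx hy ((mem_branch.1 h1).trans (mem_branch.1 h2).symm)

theorem adj_of_mem_branch (hH : H.IsTwoEdgeConnectedComponent) (hv : v ∈ H.verts)
    (hyz : G.Adj y z) (hy : y ∈ H.branch v) (hz : z ∈ H.branch v) :
    (G.deleteEdges H.edgeSet).Adj y z := by
  rw [SimpleGraph.deleteEdges_adj]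
  refine ⟨hyz, fun h => ?_⟩
  have h' : H.Adj y z := h
  have h1 := hH.eq_of_mem_branch hv (H.edge_vert h') hy
  have h2 := hH.eq_of_mem_branch hv (H.edge_vert h'.symm) hz
  exact hyz.ne (h1.trans h2.symm)

/-- A branch is joined to the rest of the graph only by the edges of `H` at its root. -/
theorem eq_and_adj_of_notMem_branch (hH : H.IsTwoEdgeConnectedComponent) (hv : v ∈ H.verts)
    (hyz : G.Adj y z) (hy : y ∈ H.branch v) (hz : z ∉ H.branch v) : y = v ∧ H.Adj v z := by
  have h : H.Adj y z := by
    by_contra h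
    refine hz (mem_branch.2 ((mem_branch.1 hy).trans (Adj.reachable ?_)))
    rw [SimpleGraph.deleteEdges_adj]
    exact ⟨hyz, h⟩
  obtain rfl := hH.eq_of_mem_branch hv (H.edge_vert h) hy
  exact ⟨rfl, h⟩

end IsTwoEdgeConnectedComponent

/-- Let `v` have degree 2 in `H`, with neighbours `u` and `w`, and replace the edge `uv` by `uw`. Then
the branch at `v` gets further from `u` by at most one, and a vertex outside the branch that `u`
reaches only through `uv` gets closer by one, as the walk to it continues from `v` to `w`. -/
theorem IsTwoEdgeConnectedComponent.edist_swap_le {H : G.Subgraph}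
    (hH : H.IsTwoEdgeConnectedComponent) {u v w : V} (hvu : H.Adj v u)
    (hvw : H.Adj v w) (hdeg : ∀ x, H.Adj v x → x = u ∨ x = w) {G' : SimpleGraph V}
    (hG' : G.deleteEdges {s(u, v)} ≤ G') (huw : G'.Adj u w) (z : V) :
    (z ∈ H.branch v → G'.edist u z ≤ G.edist u z + 1) ∧
    (z ∉ H.branch v → G.edist u z < (G.deleteEdges {s(u, v)}).edist u z →
      G'.edist u z + 1 ≤ G.edist u z) := by
  classical
  set G₁ := G.deleteEdges {s(u, v)} with hG₁
  set K := G.deleteEdges H.edgeSet with hK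
  have hv := H.edge_vert hvu
  have hKG₁ : K ≤ G₁ := SimpleGraph.deleteEdges_anti (by
    rintro _ rfl
    exact hvu.symm)
  have huT := hH.notMem_branch_of_adj hvu
  have hvT := H.self_mem_branch v
  have hwv : G'.Adj w v := hG' <| by
    rw [hG₁, SimpleGraph.deleteEdges_adj]
    refine ⟨hvw.symm.adj_sub, fun h => ?_⟩
    rcases Sym2.eq_iff.1 (Set.mem_singleton_iff.1 h) with ⟨h, -⟩ | ⟨h, -⟩
    · exact huw.ne h.symm
    · exact hvw.ne h.symm
  have hu1 : G'.edist u w = 1 := edist_eq_one_iff_adj.2 huw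
  -- Walks from `u` to the branch end with a walk inside it; walks to other vertices avoid `uv` or
  -- are shortened by the swap.
  have hf := le_edist_of_le_add_one (G := G) (x := u)
    (fun z => if z ∈ H.branch v then 1 + K.edist v z
      else min (G₁.edist u z) (G'.edist u z + 1)) (by simp [huT]) (fun y z hyz => ?_) z
  · refine ⟨fun hz => ?_, fun hz hlt => ?_⟩
    · simp only [hz, if_true] at hf
      calc G'.edist u z ≤ G'.edist u v + G'.edist v z := G'.edist_triangle
        _ ≤ (G'.edist u w + 1) + K.edist v z :=
          add_le_add (edist_le_add_one hwv) (edist_anti (hKG₁.trans hG'))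
        _ = (1 + K.edist v z) + 1 := by rw [hu1]; ring
        _ ≤ _ := by gcongr
    · simp only [hz, if_false] at hf
      exact (min_le_iff.1 hf).resolve_left (not_le.2 hlt)
  · by_cases hy : y ∈ H.branch v <;> by_cases hz : z ∈ H.branch v <;>
      simp only [hy, hz, if_true, if_false]
    · rw [add_assoc]
      exact add_le_add_right (edist_le_add_one (hH.adj_of_mem_branch hv hyz hy hz)) _
    · obtain ⟨rfl, h⟩ := hH.eq_and_adj_of_notMem_branch hv hyz hy hz
      rcases hdeg _ h with rfl | rfl
      · simp
      · refine (min_le_right _ _).trans ?_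
        simp [hu1]
    · obtain ⟨rfl, h⟩ := hH.eq_and_adj_of_notMem_branch hv hyz.symm hz hy
      simp
    · have : G₁.Adj y z := by
        rw [hG₁, SimpleGraph.deleteEdges_adj]
        refine ⟨hyz, fun h => ?_⟩
        rcases Sym2.eq_iff.1 (Set.mem_singleton_iff.1 h) with ⟨-, h⟩ | ⟨h, -⟩
        · exact hz (h ▸ hvT)
        · exact hy (h ▸ hvT)
      rw [min_add]
      exact min_le_min (edist_le_add_one this)
        (add_le_add_left (edist_le_add_one (hG' this)) _)

end SimpleGraph.Subgraph

namespace StrategyVector.IsNashEquilibrium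

open SimpleGraph Subgraph

variable {V : Type*} [Fintype V] {s : StrategyVector V} {α : ℝ} {H : s.network.Subgraph}

/-- A vertex `v` of degree 2 in `H` to which an `H`-neighbour `u` buys a link carries a large branch.
Let `A` be the set of vertices that `u` reaches only through `uv`. Dropping the link costs `u` at
most `|V(H)| - 2` for each vertex of `A`, while moving it to the other neighbour of `v` must not
pay off, so at least half of `A` lies in the branch. -/
theorem le_mul_card_branch (hs : s.IsNashEquilibrium α) (hα : 0 ≤ α)
    (hH : H.IsTwoEdgeConnectedComponent) {u v w : V} (hvu : H.Adj v u)
    (hvw : H.Adj v w) (huw : u ≠ w) (hdeg : ∀ x, H.Adj v x → x = u ∨ x = w)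
    (hlink : v ∈ s.links u) :
    α ≤ 2 * ((H.verts.ncard : ℝ) - 2) * (H.branch v).card := by
  classical
  set G₁ := s.network.deleteEdges {s(u, v)} with hG₁
  set T := H.branch v with hT
  obtain ⟨k, hk⟩ : ∃ k, H.verts.ncard = k + 2 := by
    refine Nat.exists_eq_add_of_le' ?_
    rw [← Set.ncard_pair hvu.ne]
    refine Set.ncard_le_ncard ?_
    rintro x (rfl | rfl)
    · exact H.edge_vert hvu
    · exact H.edge_vert hvu.symm
  have hd : ∀ z, (s.network.dist u z : ℕ∞) = s.network.edist u z :=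
    fun z => (hs.connected u z).coe_dist_eq_edist
  let A : Finset V := {z | s.network.edist u z < G₁.edist u z}
  have hA : ∀ z, z ∈ A ↔ s.network.edist u z < G₁.edist u z := fun z => by simp [A]
  have huv : G₁.edist u v ≤ k + 1 := by
    obtain ⟨p, hp⟩ := exists_walk_length_lt_of_adj hH.prop hvu.symm
    have hle : H.spanningCoe.deleteEdges {s(u, v)} ≤ G₁ :=
      SimpleGraph.deleteEdges_mono H.spanningCoe_le
    refine (edist_anti hle).trans (p.edist_le.trans ?_)
    have : p.length ≤ k + 1 := by omega
    exact_mod_cast this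
  -- Dropping the link lengthens the distances to the vertices of `A`, each by at most `k`.
  have hdel : α ≤ k * A.card := by
    have hS : u ∉ (s.links u).erase v := fun h => s.notMem_links u (Finset.mem_of_mem_erase h)
    have hle : G₁ ≤ (s.deviate u _ hS).network := deleteEdges_le_deviate hS (by
      intro x hx hxS
      have : x = v := by_contra fun h => hxS (Finset.mem_erase.2 ⟨h, hx⟩)
      simp [this])
    have := hs.le_of_edist_le hα hS
        (fun z => s.network.dist u z + if z ∈ A then k else 0) (fun z => by
      refine (edist_anti hle).trans ?_
      by_cases hz : z ∈ A
      · simp only [hz, if_true, Nat.cast_add, hd]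
        exact edist_deleteEdges_le_add u v huv z
      · simp only [hz, if_false, add_zero, hd]
        exact not_lt.1 fun h => hz ((hA z).2 h))
    have hc : ((s.links u).card : ℝ) = ((s.links u).erase v).card + 1 := by
      exact_mod_cast (Finset.card_erase_add_one hlink).symm
    have hsum : ∑ z, ((s.network.dist u z + if z ∈ A then k else 0 : ℕ) : ℝ) =
        ∑ z, (s.network.dist u z : ℝ) + k * A.card := by
      simp [Finset.sum_add_distrib, Finset.sum_ite_mem, mul_comm]
    rw [hsum, hc] at this
    linarith
  -- Moving the link from `v` to `w` brings `A \ T` closer by one and only `T` further by one.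
  have hswap : (A \ T).card ≤ T.card := by
    have hS : u ∉ insert w ((s.links u).erase v) := by
      simp [huw, s.notMem_links u]
    have hle : G₁ ≤ (s.deviate u _ hS).network := deleteEdges_le_deviate hS (by
      intro x hx hxS
      have : x = v := by_contra fun h => hxS (by simp [h, hx])
      simp [this])
    have hadj := adj_deviate (s := s) hS (Finset.mem_insert_self w _)
    have hsw := hH.edist_swap_le hvu hvw hdeg hle hadj
    have hpos : ∀ z ∈ A, 1 ≤ s.network.dist u z := fun z hz => by
      rw [Nat.one_le_iff_ne_zero]
      intro h0
      rw [(hs.connected u z).dist_eq_zero_iff] at h0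
      subst h0
      simp [hA] at hz
    let g : V → ℕ := fun z => if z ∈ T then s.network.dist u z + 1 else
      if z ∈ A then s.network.dist u z - 1 else s.network.dist u z
    have := hs.le_of_edist_le hα hS g (fun z => by
      by_cases hzT : z ∈ T
      · simpa [g, hzT, hd] using (hsw z).1 hzT
      · by_cases hzA : z ∈ A
        · have h1 := (hsw z).2 hzT ((hA z).1 hzA)
          rw [← hd, ← Nat.sub_add_cancel (hpos z hzA), Nat.cast_add, Nat.cast_one] at h1
          simpa [g, hzT, hzA] using (ENat.add_le_add_iff_right (by simp)).1 h1
        · simp only [g, hzT, hzA, if_false, hd]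
          exact (edist_anti hle).trans (not_lt.1 fun h => hzA ((hA z).2 h)))
    have hc : ((insert w ((s.links u).erase v)).card : ℝ) ≤ (s.links u).card := by
      have := Finset.card_insert_le w ((s.links u).erase v)
      rw [Finset.card_erase_add_one hlink] at this
      exact_mod_cast this
    have hle1 : ∑ z, (s.network.dist u z : ℝ) ≤ ∑ z, (g z : ℝ) := by
      have := mul_le_mul_of_nonneg_left hc hα
      linarith
    have hle2 : ∑ z, s.network.dist u z ≤ ∑ z, g z := by exact_mod_cast hle1
    have hle3 : ∑ z, (g z + if z ∈ A \ T then 1 else 0) ≤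
        ∑ z, (s.network.dist u z + if z ∈ T then 1 else 0) := by
      refine Finset.sum_le_sum fun z _ => ?_
      by_cases hzT : z ∈ T
      · simp [g, hzT]
      · by_cases hzA : z ∈ A
        · have := hpos z hzA
          simp [g, hzT, hzA]
          omega
        · simp [g, hzT, hzA]
    rw [Finset.sum_add_distrib, Finset.sum_add_distrib, Finset.sum_ite_mem, Finset.sum_ite_mem,
      Finset.univ_inter, Finset.univ_inter, Finset.sum_const, Finset.sum_const] at hle3
    simp only [smul_eq_mul, mul_one] at hle3
    omega
  have hAT : A.card ≤ 2 * T.card := by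
    have := Finset.card_le_card_sdiff_add_card (s := A) (t := T)
    omega
  have hAT' : (A.card : ℝ) ≤ 2 * T.card := by exact_mod_cast hAT
  have := mul_le_mul_of_nonneg_left hAT' (Nat.cast_nonneg (α := ℝ) k)
  rw [hk]
  push_cast
  linarith

end StrategyVector.IsNashEquilibrium

/-! ### Vertices of degree 2 that buy both of their links -/

namespace SimpleGraph

/-- The middle edge `ab` of a shortest walk from `x` to `y`, together with the distances of its ends
from `x` and `y`. -/
theorem exists_adj_dist_eq_half {V : Type*} {K : SimpleGraph V} {x y : V} (hxy : x ≠ y)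
    (h : K.Reachable x y) : ∃ (a b : V) (k l : ℕ), K.Adj a b ∧ K.Reachable x a ∧
      K.edist x a = k ∧ K.edist x b = k + 1 ∧ K.edist y a = l + 1 ∧ K.edist y b = l ∧
      l ≤ k ∧ k ≤ l + 1 := by
  obtain ⟨p, hp⟩ := h.exists_walk_length_eq_dist
  have hm : 0 < K.dist x y := h.pos_dist_of_ne hxy
  set m := K.dist x y with hmdef
  have hr : ∀ i, K.Reachable x (p.getVert i) := fun i => ⟨p.take i⟩
  have hr' : ∀ i, K.Reachable y (p.getVert i) := fun i => h.symm.trans (hr i)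
  have hd : ∀ i ≤ m, K.dist x (p.getVert i) = i ∧ K.dist y (p.getVert i) = m - i := by
    intro i hi
    have h1 : K.dist x (p.getVert i) ≤ i := by
      refine (dist_le (p.take i)).trans ?_
      simp
    have h2 : K.dist (p.getVert i) y ≤ m - i := by
      refine (dist_le (p.drop i)).trans ?_
      simp [hp]
    have h3 : m ≤ K.dist x (p.getVert i) + K.dist (p.getVert i) y := (hr i).dist_triangle_left y
    rw [dist_comm (u := y)]
    omega
  have hk := hd (m / 2) (by omega)
  have hk' := hd (m / 2 + 1) (by omega)
  refine ⟨p.getVert (m / 2), p.getVert (m / 2 + 1), m / 2, m - (m / 2 + 1),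
    p.adj_getVert_succ (by omega), hr _, ?_, ?_, ?_, ?_, by omega, by omega⟩
  · rw [← (hr _).coe_dist_eq_edist, hk.1]
  · rw [← (hr _).coe_dist_eq_edist, hk'.1]; rfl
  · rw [← (hr' _).coe_dist_eq_edist, hk.2]
    have : m - m / 2 = m - (m / 2 + 1) + 1 := by omega
    rw [this]; rfl
  · rw [← (hr' _).coe_dist_eq_edist, hk'.2]

namespace Subgraph.IsTwoEdgeConnectedComponent

variable {V : Type*} {G : SimpleGraph V} {H : G.Subgraph} {v v₁ v₂ : V}

theorem adj_deleteEdges_pair {y z : V} (h : G.Adj y z) (hy : y ≠ v) (hz : z ≠ v) :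
    (G.deleteEdges {s(v, v₁), s(v, v₂)}).Adj y z := by
  rw [SimpleGraph.deleteEdges_adj]
  refine ⟨h, fun h' => ?_⟩
  rcases h' with h' | h' <;>
  · rcases Sym2.eq_iff.1 h' with ⟨h1, -⟩ | ⟨-, h1⟩
    · exact hy h1
    · exact hz h1

theorem deleteEdges_edgeSet_le_deleteEdges_pair (h₁ : H.Adj v v₁) (h₂ : H.Adj v v₂) :
    G.deleteEdges H.edgeSet ≤ G.deleteEdges {s(v, v₁), s(v, v₂)} :=
  SimpleGraph.deleteEdges_anti (by
    rintro _ (rfl | rfl)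
    · exact h₁
    · exact h₂)

variable [Fintype V]

/-- If `v` has degree 2 in `H`, deleting its two edges in `H` separates its branch from the rest. -/
theorem notMem_branch_of_reachable (hH : H.IsTwoEdgeConnectedComponent) (hv : v ∈ H.verts)
    (hdeg : ∀ x, H.Adj v x → x = v₁ ∨ x = v₂) {y z : V} (hy : y ∉ H.branch v)
    (h : (G.deleteEdges {s(v, v₁), s(v, v₂)}).Reachable y z) : z ∉ H.branch v := by
  obtain ⟨p⟩ := h
  induction p with
  | nil => exact hy
  | @cons a b c hab p ih =>
    refine ih fun hb => ?_
    rw [SimpleGraph.deleteEdges_adj] at hab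
    obtain ⟨rfl, h⟩ := hH.eq_and_adj_of_notMem_branch hv hab.1.symm hb hy
    apply hab.2
    rcases hdeg _ h with rfl | rfl
    · simp [Sym2.eq_swap]
    · simp [Sym2.eq_swap]

theorem reachable_deleteEdges_pair (hH : H.IsTwoEdgeConnectedComponent) (h₁ : H.Adj v v₁)
    (hdeg : ∀ x, H.Adj v x → x = v₁ ∨ x = v₂) :
    (G.deleteEdges {s(v, v₁), s(v, v₂)}).Reachable v₁ v₂ := by
  classical
  obtain ⟨p₀, -⟩ := exists_walk_length_lt_of_adj hH.prop h₁
  obtain ⟨p, hp⟩ : ∃ p : (H.spanningCoe.deleteEdges {s(v, v₁)}).Walk v v₁, p.IsPath :=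
    ⟨p₀.bypass, p₀.bypass_isPath⟩
  cases p with
  | nil => exact absurd rfl h₁.ne
  | @cons _ c _ h p =>
    rw [SimpleGraph.deleteEdges_adj] at h
    rw [Walk.cons_isPath_iff] at hp
    have hc : c = v₂ := (hdeg c h.1).resolve_left fun hc => h.2 (by simp [hc])
    subst hc
    refine Reachable.symm ⟨p.transfer _ fun e he => ?_⟩
    induction e with | _ y z =>
    have hyz : H.Adj y z := by
      have := p.adj_of_mem_edges he
      rw [SimpleGraph.deleteEdges_adj] at this
      exact this.1
    refine adj_deleteEdges_pair hyz.adj_sub ?_ ?_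
    · rintro rfl
      exact hp.2 (p.fst_mem_support_of_mem_edges he)
    · rintro rfl
      exact hp.2 (p.snd_mem_support_of_mem_edges he)

/-- Let `v` have degree 2 in `H`, with neighbours `v₁` and `v₂`, and let `u` lie outside the branch at
`v`, at distances from `v₁` and `v₂` that differ by at most 2 when `v` is bypassed. Then `u` needs
no walk through `v` except to the branch of `v`, so after replacing the edges `vv₁`, `vv₂` by `vu`
each distance from `v` is at most one more than the former distance from `u`. -/
theorem edist_reroute_le (hH : H.IsTwoEdgeConnectedComponent) (h₁ : H.Adj v v₁)
    (h₂ : H.Adj v v₂) (hdeg : ∀ x, H.Adj v x → x = v₁ ∨ x = v₂) {G' : SimpleGraph V}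
    (hG' : G.deleteEdges {s(v, v₁), s(v, v₂)} ≤ G') {u : V} (hu : u ∉ H.branch v)
    (huv : G'.Adj v u)
    (hu₁ : (G.deleteEdges {s(v, v₁), s(v, v₂)}).edist v₁ u ≤
      (G.deleteEdges {s(v, v₁), s(v, v₂)}).edist v₂ u + 2)
    (hu₂ : (G.deleteEdges {s(v, v₁), s(v, v₂)}).edist v₂ u ≤
      (G.deleteEdges {s(v, v₁), s(v, v₂)}).edist v₁ u + 2) (z : V) :
    G'.edist v z ≤ 1 + G.edist u z := by
  classical
  set K := G.deleteEdges {s(v, v₁), s(v, v₂)} with hK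
  have hv := H.edge_vert h₁
  have hvT := H.self_mem_branch v
  have hf := le_edist_of_le_add_one (G := G) (x := u)
    (fun z => if z ∈ H.branch v then 1 + min (K.edist v₁ u) (K.edist v₂ u) + K.edist v z
      else K.edist u z) (by simp [hu]) (fun y z hyz => ?_) z
  · by_cases hz : z ∈ H.branch v
    · simp only [hz, if_true] at hf
      exact ((edist_anti hG').trans le_add_self).trans (hf.trans le_add_self)
    · simp only [hz, if_false] at hf
      calc G'.edist v z ≤ G'.edist v u + G'.edist u z := G'.edist_triangle
        _ ≤ 1 + K.edist u z :=
          add_le_add (edist_eq_one_iff_adj.2 huv).le (edist_anti hG')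
        _ ≤ _ := by gcongr
  · by_cases hy : y ∈ H.branch v <;> by_cases hz : z ∈ H.branch v <;>
      simp only [hy, hz, if_true, if_false]
    · rw [add_assoc _ (K.edist v y)]
      exact add_le_add_right (edist_le_add_one
        (deleteEdges_edgeSet_le_deleteEdges_pair h₁ h₂ (hH.adj_of_mem_branch hv hyz hy hz))) _
    · obtain ⟨rfl, h⟩ := hH.eq_and_adj_of_notMem_branch hv hyz hy hz
      rw [edist_self, add_zero, add_comm, ← add_assoc, one_add_one_eq_two, add_comm, min_add,
        edist_comm]
      rcases hdeg _ h with rfl | rfl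
      · exact le_min le_self_add hu₁
      · exact le_min hu₂ le_self_add
    · obtain ⟨rfl, h⟩ := hH.eq_and_adj_of_notMem_branch hv hyz.symm hz hy
      rw [edist_self, add_zero, add_comm, edist_comm (u := u)]
      gcongr
      rcases hdeg _ h with rfl | rfl
      · exact min_le_left _ _
      · exact min_le_right _ _
    · refine edist_le_add_one (adj_deleteEdges_pair hyz ?_ ?_)
      · rintro rfl
        exact hy hvT
      · rintro rfl
        exact hz hvT

theorem one_add_min_edist_le (hH : H.IsTwoEdgeConnectedComponent) (h₁ : H.Adj v v₁)
    (hdeg : ∀ x, H.Adj v x → x = v₁ ∨ x = v₂) {z : V} (hz : z ∉ H.branch v) :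
    1 + min ((G.deleteEdges {s(v, v₁), s(v, v₂)}).edist v₁ z)
      ((G.deleteEdges {s(v, v₁), s(v, v₂)}).edist v₂ z) ≤ G.edist v z := by
  classical
  set K := G.deleteEdges {s(v, v₁), s(v, v₂)} with hK
  have hv := H.edge_vert h₁
  have hvT := H.self_mem_branch v
  have hf := le_edist_of_le_add_one (G := G) (x := v)
    (fun z => if z ∈ H.branch v then 0 else 1 + min (K.edist v₁ z) (K.edist v₂ z))
    (by simp [hvT]) (fun y z hyz => ?_) z
  · simpa only [hz, if_false] using hf
  · by_cases hy : y ∈ H.branch v <;> by_cases hz : z ∈ H.branch v <;>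
      simp only [hy, hz, if_true, if_false]
    · simp
    · obtain ⟨rfl, h⟩ := hH.eq_and_adj_of_notMem_branch hv hyz hy hz
      rcases hdeg _ h with rfl | rfl <;> simp
    · simp
    · have : K.Adj y z := by
        refine adj_deleteEdges_pair hyz ?_ ?_
        · rintro rfl
          exact hy hvT
        · rintro rfl
          exact hz hvT
      rw [add_assoc, min_add]
      exact add_le_add_right (min_le_min (edist_le_add_one this) (edist_le_add_one this)) _

/-- Let `v` have degree 2 in `H`. The edge `ab` opposite to `v` on a shortest cycle through `v` is
not needed for the distances from `v`, and each of its ends satisfies the assumptions of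
`edist_reroute_le`. -/
theorem exists_antipodal_adj (hH : H.IsTwoEdgeConnectedComponent) (h₁ : H.Adj v v₁)
    (h₂ : H.Adj v v₂) (hne : v₁ ≠ v₂) (hdeg : ∀ x, H.Adj v x → x = v₁ ∨ x = v₂) :
    ∃ a b, G.Adj a b ∧
      (∀ u ∈ ({a, b} : Set V), u ∉ H.branch v ∧
        (G.deleteEdges {s(v, v₁), s(v, v₂)}).edist v₁ u ≤
          (G.deleteEdges {s(v, v₁), s(v, v₂)}).edist v₂ u + 2 ∧
        (G.deleteEdges {s(v, v₁), s(v, v₂)}).edist v₂ u ≤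
          (G.deleteEdges {s(v, v₁), s(v, v₂)}).edist v₁ u + 2) ∧
      ∀ z, (G.deleteEdges {s(a, b)}).edist v z ≤ G.edist v z := by
  classical
  set K := G.deleteEdges {s(v, v₁), s(v, v₂)} with hK
  have hv := H.edge_vert h₁
  have hvT := H.self_mem_branch v
  obtain ⟨a, b, k, l, hab, hr, h1a, h1b, h2a, h2b, hlk, hkl⟩ :=
    exists_adj_dist_eq_half hne (hH.reachable_deleteEdges_pair h₁ hdeg)
  have haT := hH.notMem_branch_of_reachable hv hdeg (hH.notMem_branch_of_adj h₁) hr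
  have hbT := hH.notMem_branch_of_reachable hv hdeg haT hab.reachable
  have hva : v ≠ a := fun h => haT (h ▸ hvT)
  have hvb : v ≠ b := fun h => hbT (h ▸ hvT)
  have hdel : ∀ x, (G.deleteEdges {s(a, b)}).edist x ≤ (K.deleteEdges {s(a, b)}).edist x :=
    fun x z => edist_anti (SimpleGraph.deleteEdges_mono (SimpleGraph.deleteEdges_le _))
  have hvx : ∀ x, H.Adj v x → (G.deleteEdges {s(a, b)}).edist v x ≤ 1 := by
    intro x hx
    rw [edist_le_one_iff_adj_or_eq, SimpleGraph.deleteEdges_adj]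
    refine .inl ⟨hx.adj_sub, fun h => ?_⟩
    rcases Sym2.eq_iff.1 (Set.mem_singleton_iff.1 h) with ⟨h, -⟩ | ⟨h, -⟩
    · exact hva h
    · exact hvb h
  have hb : (G.deleteEdges {s(a, b)}).edist v b ≤ 1 + l := by
    refine (SimpleGraph.edist_triangle (v := v₂)).trans (add_le_add (hvx _ h₂) ?_)
    refine (hdel _ _).trans ((edist_deleteEdges_le_of_lt ?_).trans h2b.le)
    rw [h2a, h2b]
    exact_mod_cast Nat.lt_succ_self l
  have ha : (G.deleteEdges {s(a, b)}).edist v a ≤ 1 + k := by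
    refine (SimpleGraph.edist_triangle (v := v₁)).trans (add_le_add (hvx _ h₁) ?_)
    refine (hdel _ _).trans ?_
    rw [Sym2.eq_swap]
    refine (edist_deleteEdges_le_of_lt ?_).trans h1a.le
    rw [h1a, h1b]
    exact_mod_cast Nat.lt_succ_self k
  refine ⟨a, b, SimpleGraph.deleteEdges_le _ hab, ?_, edist_deleteEdges_le ?_ ?_⟩
  · rintro u (rfl | rfl)
    · refine ⟨haT, ?_, ?_⟩
      · rw [h1a, h2a]; exact_mod_cast (by omega : k ≤ l + 1 + 2)
      · rw [h1a, h2a]; exact_mod_cast (by omega : l + 1 ≤ k + 2)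
    · refine ⟨hbT, ?_, ?_⟩
      · rw [h1b, h2b]; exact_mod_cast (by omega : k + 1 ≤ l + 2)
      · rw [h1b, h2b]; exact_mod_cast (by omega : l ≤ k + 1 + 2)
  · have := hH.one_add_min_edist_le h₁ hdeg haT
    rw [← hK, h1a, h2a] at this
    refine hb.trans (le_trans ?_ (add_le_add_left this 1))
    rw [add_assoc, min_add]
    refine add_le_add_right (le_min ?_ (le_self_add.trans le_self_add)) 1
    exact_mod_cast hlk.trans (Nat.le_succ k)
  · have := hH.one_add_min_edist_le h₁ hdeg hbT
    rw [← hK, h1b, h2b] at this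
    refine ha.trans (le_trans ?_ (add_le_add_left this 1))
    rw [add_assoc, min_add]
    refine add_le_add_right (le_min (le_self_add.trans le_self_add) ?_) 1
    exact_mod_cast hkl

end Subgraph.IsTwoEdgeConnectedComponent

end SimpleGraph

namespace StrategyVector.IsNashEquilibrium

open SimpleGraph Subgraph

variable {V : Type*} [Fintype V] {s : StrategyVector V} {α : ℝ} {H : s.network.Subgraph}

/-- A vertex `v` of degree 2 in `H` does not buy both of its links in `H`. Otherwise let `u` be a buyer
of the edge opposite to `v`. If `v` replaces its two links by one to `u`, or `u` replaces the
opposite link by one to `v`, then each distance of the deviating player is at most one more than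
that of the other player before. The two equilibrium inequalities add up to `α ≤ 2n`. -/
theorem exists_mem_links (hs : s.IsNashEquilibrium α) (hα : 2 * (Fintype.card V : ℝ) < α)
    (hH : H.IsTwoEdgeConnectedComponent) {v v₁ v₂ : V} (h₁ : H.Adj v v₁)
    (h₂ : H.Adj v v₂) (hne : v₁ ≠ v₂) (hdeg : ∀ x, H.Adj v x → x = v₁ ∨ x = v₂) :
    v ∈ s.links v₁ ∨ v ∈ s.links v₂ := by
  classical
  by_contra! hnot
  have hv₁ : v₁ ∈ s.links v := h₁.adj_sub.resolve_right hnot.1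
  have hv₂ : v₂ ∈ s.links v := h₂.adj_sub.resolve_right hnot.2
  have hα0 : 0 ≤ α := by
    have : (0 : ℝ) ≤ Fintype.card V := by positivity
    linarith
  have hd : ∀ x z, (s.network.dist x z : ℕ∞) = s.network.edist x z :=
    fun x z => (hs.connected x z).coe_dist_eq_edist
  have key : ∀ u u', u' ∈ s.links u → u ∉ H.branch v →
      (s.network.deleteEdges {s(v, v₁), s(v, v₂)}).edist v₁ u ≤
        (s.network.deleteEdges {s(v, v₁), s(v, v₂)}).edist v₂ u + 2 →
      (s.network.deleteEdges {s(v, v₁), s(v, v₂)}).edist v₂ u ≤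
        (s.network.deleteEdges {s(v, v₁), s(v, v₂)}).edist v₁ u + 2 →
      (∀ z, (s.network.deleteEdges {s(u, u')}).edist v z ≤ s.network.edist v z) → False := by
    intro u u' huu' huT hu₁ hu₂ hz
    have huv : u ≠ v := fun h => huT (h ▸ H.self_mem_branch v)
    -- `u` moves its link from `u'` to `v`.
    have hdu : α * (s.links u).card + ∑ z, (s.network.dist u z : ℝ) ≤
        α * (s.links u).card + ∑ z, ((1 + s.network.dist v z : ℕ) : ℝ) := by
      have hS : u ∉ insert v ((s.links u).erase u') := by simp [huv, s.notMem_links u]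
      have hle : s.network.deleteEdges {s(u, u')} ≤ (s.deviate u _ hS).network :=
        deleteEdges_le_deviate hS (by
          intro x hx hxS
          have : x = u' := by_contra fun h => hxS (by simp [h, hx])
          simp [this])
      have hadj := adj_deviate (s := s) hS (Finset.mem_insert_self v _)
      refine (hs.le_of_edist_le hα0 hS (fun z => 1 + s.network.dist v z) fun z => ?_).trans ?_
      · refine (SimpleGraph.edist_triangle (v := v)).trans ?_
        rw [Nat.cast_add, hd, Nat.cast_one]
        exact add_le_add (edist_eq_one_iff_adj.2 hadj).le ((edist_anti hle).trans (hz z))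
      · have := Finset.card_insert_le v ((s.links u).erase u')
        rw [Finset.card_erase_add_one huu'] at this
        gcongr
    -- `v` replaces its two links by a link to `u`.
    have hdv : α * (s.links v).card + ∑ z, (s.network.dist v z : ℝ) ≤
        α * ((s.links v).card - 1) + ∑ z, ((1 + s.network.dist u z : ℕ) : ℝ) := by
      have hS : v ∉ insert u (((s.links v).erase v₁).erase v₂) := by
        simp [huv.symm, s.notMem_links v]
      have hle : s.network.deleteEdges {s(v, v₁), s(v, v₂)} ≤ (s.deviate v _ hS).network :=
        deleteEdges_le_deviate hS (by
          intro x hx hxS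
          by_cases hx1 : x = v₁
          · simp [hx1]
          · have : x = v₂ := by_contra fun h => hxS (by simp [h, hx1, hx])
            simp [this])
      have hadj := adj_deviate (s := s) hS (Finset.mem_insert_self u _)
      refine (hs.le_of_edist_le hα0 hS (fun z => 1 + s.network.dist u z) fun z => ?_).trans ?_
      · rw [Nat.cast_add, hd, Nat.cast_one]
        exact hH.edist_reroute_le h₁ h₂ hdeg hle huT hadj hu₁ hu₂ z
      · gcongr
        rw [le_sub_iff_add_le]
        have h1 := Finset.card_insert_le u (((s.links v).erase v₁).erase v₂)
        rw [Finset.card_erase_add_one (by simp [hne.symm, hv₂])] at h1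
        have h2 := Finset.card_erase_add_one hv₁
        exact_mod_cast (by omega : (insert u (((s.links v).erase v₁).erase v₂)).card + 1 ≤ _)
    simp only [Nat.cast_add, Nat.cast_one, Finset.sum_add_distrib, Finset.sum_const,
      Finset.card_univ, nsmul_eq_mul, mul_one] at hdu hdv
    linarith
  obtain ⟨a, b, hab, hu, hz⟩ := hH.exists_antipodal_adj h₁ h₂ hne hdeg
  rcases hab with h | h
  · obtain ⟨hT, hl, hr⟩ := hu a (by simp)
    exact key a b h hT hl hr hz
  · obtain ⟨hT, hl, hr⟩ := hu b (by simp)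
    exact key b a h hT hl hr (by rwa [Sym2.eq_swap])

end StrategyVector.IsNashEquilibrium

/-! ### Counting the vertices of degree 2 -/

namespace StrategyVector.IsNashEquilibrium

open SimpleGraph Subgraph

variable {V : Type*} [Fintype V] {s : StrategyVector V} {α : ℝ} {H : s.network.Subgraph}

theorem le_mul_card_branch_of_degree_eq_two (hs : s.IsNashEquilibrium α)
    (hα : 2 * (Fintype.card V : ℝ) < α) (hH : H.IsTwoEdgeConnectedComponent) {v : V}
    (hv : (H.neighborSet v).ncard = 2) :
    α ≤ 2 * ((H.verts.ncard : ℝ) - 2) * (H.branch v).card := by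
  have hα0 : 0 ≤ α := by
    have : (0 : ℝ) ≤ Fintype.card V := by positivity
    linarith
  obtain ⟨v₁, v₂, hne, hN⟩ := Set.ncard_eq_two.1 hv
  have hmem : ∀ x, H.Adj v x ↔ x = v₁ ∨ x = v₂ := fun x => by
    rw [← Subgraph.mem_neighborSet, hN]
    simp
  have h₁ : H.Adj v v₁ := (hmem v₁).2 (.inl rfl)
  have h₂ : H.Adj v v₂ := (hmem v₂).2 (.inr rfl)
  rcases hs.exists_mem_links hα hH h₁ h₂ hne fun x => (hmem x).1 with h | h
  · exact hs.le_mul_card_branch hα0 hH h₁ h₂ hne (fun x => (hmem x).1) h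
  · exact hs.le_mul_card_branch hα0 hH h₂ h₁ hne.symm (fun x hx => ((hmem x).1 hx).symm) h

/-- At most half of the vertices of `H` have degree 2 in `H`: their branches are disjoint and each
contains at least `α / (2 (|V(H)| - 2))` of the fewer than `α / 4` vertices. -/
theorem two_mul_card_le (hs : s.IsNashEquilibrium α)
    (hα : 4 * (Fintype.card V : ℝ) < α) (hH : H.IsTwoEdgeConnectedComponent)
    (N : Finset V) (hN : ∀ v ∈ N, v ∈ H.verts ∧ (H.neighborSet v).ncard = 2) :
    2 * N.card ≤ H.verts.ncard := by
  classical
  rcases N.eq_empty_or_nonempty with rfl | ⟨v₀, hv₀⟩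
  · simp
  have hn : (0 : ℝ) < Fintype.card V := by
    exact_mod_cast Fintype.card_pos_iff.2 ⟨v₀⟩
  have hb : ∀ v ∈ N, α ≤ 2 * ((H.verts.ncard : ℝ) - 2) * (H.branch v).card := fun v hv =>
    hs.le_mul_card_branch_of_degree_eq_two (by linarith) hH (hN v hv).2
  have hsum : N.card * α ≤ 2 * ((H.verts.ncard : ℝ) - 2) * ∑ v ∈ N, ((H.branch v).card : ℝ) := by
    rw [Finset.mul_sum, ← nsmul_eq_mul]
    exact Finset.card_nsmul_le_sum _ _ _ hb
  have hdisj : ∑ v ∈ N, (H.branch v).card ≤ Fintype.card V := by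
    rw [← Finset.card_biUnion]
    · exact Finset.card_le_univ _
    · exact fun x hx y hy hxy => hH.disjoint_branch (hN x hx).1 (hN y hy).1 hxy
  have hdisj' : ∑ v ∈ N, ((H.branch v).card : ℝ) ≤ Fintype.card V := by exact_mod_cast hdisj
  -- The bound on a single branch excludes `|V(H)| < 2`.
  have hh : 0 ≤ (H.verts.ncard : ℝ) - 2 := by
    by_contra! hneg
    have h1 := hb v₀ hv₀
    have : ((H.verts.ncard : ℝ) - 2) * (H.branch v₀).card ≤ 0 :=
      mul_nonpos_of_nonpos_of_nonneg hneg.le (Nat.cast_nonneg _)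
    linarith
  have h2 : 2 * (N.card : ℝ) * α ≤ ((H.verts.ncard : ℝ) - 2) * α :=
    calc 2 * (N.card : ℝ) * α ≤
          2 * (2 * ((H.verts.ncard : ℝ) - 2) * ∑ v ∈ N, ((H.branch v).card : ℝ)) := by linarith
      _ ≤ 2 * (2 * ((H.verts.ncard : ℝ) - 2) * Fintype.card V) := by gcongr
      _ = ((H.verts.ncard : ℝ) - 2) * (4 * Fintype.card V) := by ring
      _ ≤ _ := by gcongr
  have h3 := le_of_mul_le_mul_right h2 (by linarith : (0 : ℝ) < α)
  have h4 : 2 * (N.card : ℝ) ≤ H.verts.ncard := by linarith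
  exact_mod_cast h4

end StrategyVector.IsNashEquilibrium

namespace SimpleGraph.Subgraph

variable {V : Type*} [Fintype V] {G : SimpleGraph V} {H : G.Subgraph}

theorem two_le_ncard_neighborSet (hH : H.coe.IsTwoEdgeConnected) (hn : H.verts.Nontrivial)
    {v : V} (hv : v ∈ H.verts) : 2 ≤ (H.neighborSet v).ncard := by
  have := hn.coe_sort
  obtain ⟨⟨x, hx⟩, hvx⟩ := hH.1.preconnected.exists_adj_of_nontrivial ⟨v, hv⟩
  have hvx' : H.Adj v x := hvx
  obtain ⟨y, hyx, hvy⟩ := exists_adj_ne hH hvx'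
  rw [← Set.ncard_pair hyx.symm]
  refine Set.ncard_le_ncard ?_
  rintro z (rfl | rfl)
  · exact hvx'
  · exact hvy

end SimpleGraph.Subgraph

theorem mainTheorem3 {V : Type*} [Fintype V] (s : StrategyVector V) (α : ℝ)
    (hα : 4 * (Fintype.card V : ℝ) < α) (hs : s.IsNashEquilibrium α)
    (H : s.network.Subgraph) (hH : H.IsTwoEdgeConnectedComponent)
    (hgirth : 20 ≤ s.network.egirth) (hdiam : 126 ≤ H.coe.diam) :
    2 + 1 / 2 ≤ H.averageDegree := by
  classical
  have hn : H.verts.Nontrivial := by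
    by_contra h
    rw [Set.not_nontrivial_iff] at h
    have : Subsingleton H.verts := h.coe_sort
    rw [SimpleGraph.diam_eq_zero.2 (.inr this)] at hdiam
    omega
  have hdeg : ∀ v, H.degree v = (H.neighborSet v).ncard := fun v => by
    rw [SimpleGraph.Subgraph.degree, Set.ncard_eq_toFinset_card', Set.toFinset_card]
  have hcard : H.verts.toFinset.card = H.verts.ncard := (Set.ncard_eq_toFinset_card' _).symm
  let N : Finset V := {v ∈ H.verts.toFinset | (H.neighborSet v).ncard = 2}
  have hN := hs.two_mul_card_le hα hH N (fun v hv => by simpa [N] using hv)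
  -- Every vertex of `H` has degree at least 2 in `H`, and at least 3 if it is not in `N`.
  have hsum : 3 * H.verts.toFinset.card ≤ ∑ v ∈ H.verts.toFinset, H.degree v + N.card := by
    rw [mul_comm, ← smul_eq_mul, ← Finset.sum_const, Finset.card_filter, ← Finset.sum_add_distrib]
    refine Finset.sum_le_sum fun v hv => ?_
    have := SimpleGraph.Subgraph.two_le_ncard_neighborSet hH.prop hn (Set.mem_toFinset.1 hv)
    rw [hdeg]
    split_ifs <;> omega
  have hpos : (0 : ℝ) < H.verts.toFinset.card := by
    exact_mod_cast Finset.card_pos.2 (Set.toFinset_nonempty.2 hn.nonempty)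
  rw [SimpleGraph.Subgraph.averageDegree, le_div_iff₀ (by convert hpos)]
  have h5 : 5 * H.verts.toFinset.card ≤ 2 * ∑ v ∈ H.verts.toFinset, H.degree v := by omega
  have h6 : 5 * (H.verts.toFinset.card : ℝ) ≤ 2 * ∑ v ∈ H.verts.toFinset, (H.degree v : ℝ) := by
    exact_mod_cast h5
  have h7 : (2 + 1 / 2) * (H.verts.toFinset.card : ℝ) ≤
      ∑ v ∈ H.verts.toFinset, (H.degree v : ℝ) := by linarith
  -- Only the decidability instances inside `averageDegree` differ.
  convert h7
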